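/- \textbf{Setting.} Consider programs of hybrid active objects (language HABS): a program is a list of classes and a main block. A class $C$ has discrete fields (some of them creation parameters), physical fields $f$ with initial values and differential equations $f'=de$ (jointly $\mathsf{ode}_C$), an initializing block, methods, a creation condition $\mathsf{pre}_C$ and an object invariant $I_C$. A method $C.m$ has parameters, a precondition $\mathsf{pre}_{C.m}$, a postcondition $\mathsf{post}_{C.m}$ and a body $\mathsf{await}_p\,g;\,s;\,\mathsf{return}\,e$, where $g$ is its leading guard. Statements are $\mathsf{skip}$, assignments whose right-hand side is an expression, an object creation $\mathsf{new}\ D(\bar e)$, a future read $e.\mathsf{get}$ or an asynchronous call $e!m(\bar e)$, sequences, branchings, loops, $\mathsf{await}_p\,g$ with $g$ of the form $e?$, $\mathsf{duration}(e)$ or $\mathsf{diff}\,e$, and $\mathsf{duration}(e)$. Programs are well-formed: class names are unique, method names are unique within a class, every called method is declared. A \emph{unit} is a method, a constructor $C.\mathsf{init}$ (initialization of the physical fields followed by the initializing block) or the main block; methods and the constructor of $C$ are the units of $C$. \textbf{Locally controlled regions.} The weak negation $\widetilde\neg\varphi$ of a formula is its negation, pushed through $\wedge$ and $\vee$, except that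 $\widetilde\neg(a\le b)$ is $a\ge b$ and $\widetilde\neg(a\ge b)$ is $a\le b$. The external trigger of a guard is $e$ for $\mathsf{diff}\,e$, $\mathtt t\ge e$ for $\mathsf{duration}(e)$, and $\mathsf{false}$ for $e?$; $\mathit{ttrig}_m$ is the trigger of the leading guard of $m$. The causality graph of a unit is its control-flow graph: one node per basic statement (including the final return), and an additional in-node and out-node for each branching and loop. A method path of a node $n$ is a path to $n$ that starts in the entry node, or in an $\mathsf{await}$ node and then has at least one edge, with no $\mathsf{await}$ node strictly between its ends. For a unit $x$ of $C$, $\mathsf{gcall}(x)$ is the set of methods $m$ of $C$ such that every method path of the exit node of $x$ contains a call of $m$ on $\mathsf{this}$; $\mathsf{gcall}(p)$ is defined in the same way for the node $\mathsf{await}_p$. The generator $\Psi^{\mathsf{local}}$ maps $x$, respectively $p$, to $\bigwedge_{m\in\mathsf{gcall}(\cdot)}\widetilde\neg\mathit{ttrig}_m$. \textbf{Proof obligations.} Let $\mathsf{pr}(\psi)$ be $I_C\wedge[\mathtt t:=0;\{\mathsf{ode}_C,\mathtt t'=1\ \&\ \psi\}]I_C$. In differential dynamic logic $d\mathcal L$,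 with $\Psi=\Psi^{\mathsf{local}}$, the obligations are \[\begin{aligned} \iota_{C.\mathsf{init}}&\equiv \mathsf{pre}_C\wedge\mathtt{cll}\doteq0\to[\mathsf{trans}(s_{C.\mathsf{init}})]\big(\mathtt{cll}\doteq0\wedge\mathsf{pr}(\Psi(C.\mathsf{init}))\big),\\ \iota_{C.m}&\equiv I_C\wedge\mathsf{pre}_{C.m}\wedge\mathtt{cll}\doteq0\to[\mathsf{trans}(s_{C.m})]\big(\mathtt{cll}\doteq0\wedge\mathsf{post}_{C.m}\wedge\mathsf{pr}(\Psi(C.m))\big),\\ \iota_{\mathsf{main}}&\equiv\mathtt{cll}\doteq0\to[\mathsf{trans}(s_{\mathsf{main}})]\,\mathtt{cll}\doteq0 . \end{aligned}\] The main block is treated as a unit of a special class without fields and dynamics and with invariant $\mathsf{true}$. The translation $\mathsf{trans}$ keeps assignments of expressions, sequences, branchings and loops; $\mathsf{return}\ e$ becomes $\mathtt{result}:=e$. A check of $\varphi$ is $\{?\varphi\}\cup\{?\neg\varphi;\mathtt{cll}:=1\}$. A call checks the precondition of the called method for the passed arguments, a creation checks the creation condition; then the target gets an arbitrary value. For $\mathsf{await}_p\,g$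 one checks $\mathsf{pr}(\Psi(p)\wedge\widetilde\neg\,\mathsf{trans}(g))$, gives all fields arbitrary values, and tests $\mathsf{trans}(g)$, together with $I_C$ if the check succeeded; here $\mathsf{trans}(\mathsf{diff}\,e)=e$ and $\mathsf{trans}(g)=\mathsf{true}$ for other guards. For $\mathsf{get}$ one checks $\mathsf{pr}(\mathsf{true})$, gives the physical fields arbitrary values, tests $I_C$ if the check succeeded, and gives the target an arbitrary value. For $\mathsf{duration}(e)$ one checks, with $\mathtt t:=0$, $\mathsf{pr}(\mathtt t\le e)$ and then runs $\mathtt t:=0;\{\mathsf{ode}_C,\mathtt t'=1\ \&\ \mathtt t\le e\};?\mathtt t\ge e$. The leading $\mathsf{await}_p\,g$ of a method may be translated either as above or, uniformly for all methods, as the test $?\mathsf{trans}(g)$; the lemma holds for both conventions. A class (or the main block) is \emph{verified} in a program (``safe according to locally controlled regions'') if all obligations of its units for $\Psi^{\mathsf{local}}$, computed in this program, are valid. \textbf{Lemma.} Let $P$ be a well-formed program and let $C$ be a class that is verified in $P$. \begin{enumerate} \item Let $m^-$ be a method of $C$, and let $P^-$ be $P$ with $m^-$ removed from $C$ and all calls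 to it, in the whole program, replaced by $\mathsf{skip}$. Then the resulting class $C^-$ is verified in $P^-$ if and only if the obligations, in $P^-$, of those units of $C^-$ are valid that call $m^-$ in $P$. In the same sense, any other class and the main block, if verified in $P$, is verified in $P^-$ as soon as the obligations in $P^-$ of its units calling $m^-$ in $P$ are valid. \item Let $m^+$ be a method whose name is not used in $C$, and let $P^+$ be $P$ with $m^+$ added to $C$. Then the resulting class $C^+$ is verified in $P^+$ if and only if the obligation of $m^+$ in $P^+$ is valid. Any other class and the main block, if verified in $P$, is verified in $P^+$. \item Suppose that, besides adding $m^+$ to $C$, one replaces the code (not the contract or the leading guard of a method) of arbitrary units, of $C$ or of other classes, by code that calls $m^+$. Then any class, and the main block, that is verified in $P$ is verified in the new program as soon as, in the new program, the obligations of its units that call $m^+$ are valid, and, in the case of the class $C$, also the obligation of $m^+$. \end{enumerate} -/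

import Mathlib

/-! ## Differential dynamic logic -/

/-- Variables of the logic: fields and local variables of programs, the reference `this`, the
special variables `t` (time), `cll` (contract violations), `result` (return value), and auxiliary
variables used only to pass several arguments simultaneously. -/
inductive DVar where
  | field (f : ℕ)
  | loc (v : ℕ)
  | self
  | time
  | cll
  | result
  | tmp (i : ℕ)
  deriving DecidableEq

/-- Valuations. -/
abbrev DState := DVar → ℝ

/-- Terms. The operators `le`, `ge`, `and`, `or`, `not` are `0/1`-valued functions, with `1` for
truth; they are needed only where a Boolean expression is assigned to a variable. -/
inductive Term where
  | var (x : DVar)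
  | const (r : ℝ)
  | add (a b : Term)
  | sub (a b : Term)
  | mul (a b : Term)
  | div (a b : Term)
  | le (a b : Term)
  | ge (a b : Term)
  | and (a b : Term)
  | or (a b : Term)
  | not (a : Term)

open Classical in
noncomputable def Term.eval (σ : DState) : Term → ℝ
  | .var x => σ x
  | .const r => r
  | .add a b => a.eval σ + b.eval σ
  | .sub a b => a.eval σ - b.eval σ
  | .mul a b => a.eval σ * b.eval σ
  | .div a b => a.eval σ / b.eval σ
  | .le a b => if a.eval σ ≤ b.eval σ then 1 else 0
  | .ge a b => if a.eval σ ≥ b.eval σ then 1 else 0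
  | .and a b => if a.eval σ = 1 ∧ b.eval σ = 1 then 1 else 0
  | .or a b => if a.eval σ = 1 ∨ b.eval σ = 1 then 1 else 0
  | .not a => if a.eval σ = 1 then 0 else 1

/-- Differential terms: terms extended with the derivation operator `(t)'`. -/
inductive DTerm where
  | base (t : Term)
  | diff (t : Term)
  | add (a b : DTerm)
  | sub (a b : DTerm)
  | mul (a b : DTerm)
  | div (a b : DTerm)

/-- Value of a differential term at time `s` of the trajectory `X` on `[0, r]`. -/
noncomputable def DTerm.eval (X : ℝ → DState) (r s : ℝ) : DTerm → ℝ
  | .base t => t.eval (X s)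
  | .diff t => derivWithin (fun u => t.eval (X u)) (Set.Icc 0 r) s
  | .add a b => a.eval X r s + b.eval X r s
  | .sub a b => a.eval X r s - b.eval X r s
  | .mul a b => a.eval X r s * b.eval X r s
  | .div a b => a.eval X r s / b.eval X r s

/-- All derivatives that occur in a differential term exist. -/
def DTerm.Defined (X : ℝ → DState) (r s : ℝ) : DTerm → Prop
  | .base _ => True
  | .diff t => DifferentiableWithinAt ℝ (fun u => t.eval (X u)) (Set.Icc 0 r) s
  | .add a b => a.Defined X r s ∧ b.Defined X r s
  | .sub a b => a.Defined X r s ∧ b.Defined X r s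
  | .mul a b => a.Defined X r s ∧ b.Defined X r s
  | .div a b => a.Defined X r s ∧ b.Defined X r s

/-- A system of ordinary differential equations `x' = d`. -/
abbrev ODE := List (DVar × DTerm)

/-- `X` solves the system on `[0, r]`; variables without an equation stay constant. -/
def ODE.IsSolution (eqs : ODE) (r : ℝ) (X : ℝ → DState) : Prop :=
  ∀ s ∈ Set.Icc (0 : ℝ) r,
    (∀ x : DVar, x ∉ eqs.map Prod.fst → X s x = X 0 x) ∧
    ∀ eq ∈ eqs, eq.2.Defined X r s ∧
      HasDerivWithinAt (fun u => X u eq.1) (eq.2.eval X r s) (Set.Icc 0 r) s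

mutual
/-- Formulas. -/
inductive Fml where
  | tru
  | eq (a b : Term)
  | le (a b : Term)
  | ge (a b : Term)
  | not (φ : Fml)
  | and (φ ψ : Fml)
  | or (φ ψ : Fml)
  | ex (x : DVar) (φ : Fml)
  | box (α : HProg) (φ : Fml)

/-- Hybrid programs. -/
inductive HProg where
  | assign (x : DVar) (t : Term)
  | havoc (x : DVar)
  | choice (α β : HProg)
  | star (α : HProg)
  | test (φ : Fml)
  | seq (α β : HProg)
  | ode (eqs : ODE) (dom : Fml)
end

mutual
/-- Satisfaction of a formula in a valuation. -/
def Fml.Sat : Fml → DState → Prop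
  | .tru, _ => True
  | .eq a b, σ => a.eval σ = b.eval σ
  | .le a b, σ => a.eval σ ≤ b.eval σ
  | .ge a b, σ => a.eval σ ≥ b.eval σ
  | .not φ, σ => ¬ φ.Sat σ
  | .and φ ψ, σ => φ.Sat σ ∧ ψ.Sat σ
  | .or φ ψ, σ => φ.Sat σ ∨ ψ.Sat σ
  | .ex x φ, σ => ∃ r : ℝ, φ.Sat (Function.update σ x r)
  | .box α φ, σ => ∀ σ' : DState, α.Reach σ σ' → φ.Sat σ'

/-- `α.Reach σ σ'`: the hybrid program `α` can terminate in `σ'` when started in `σ`. -/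
def HProg.Reach : HProg → DState → DState → Prop
  | .assign x t, σ, σ' => σ' = Function.update σ x (t.eval σ)
  | .havoc x, σ, σ' => ∃ r : ℝ, σ' = Function.update σ x r
  | .choice α β, σ, σ' => α.Reach σ σ' ∨ β.Reach σ σ'
  | .star α, σ, σ' => Relation.ReflTransGen (fun a b => α.Reach a b) σ σ'
  | .test φ, σ, σ' => σ' = σ ∧ φ.Sat σ
  | .seq α β, σ, σ' => ∃ ρ : DState, α.Reach σ ρ ∧ β.Reach ρ σ'
  | .ode eqs dom, σ, σ' => ∃ r : ℝ, 0 ≤ r ∧ ∃ X : ℝ → DState,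
      X 0 = σ ∧ X r = σ' ∧ eqs.IsSolution r X ∧ ∀ s ∈ Set.Icc (0 : ℝ) r, dom.Sat (X s)
end

/-- Validity: truth in every valuation. -/
def Fml.Valid (φ : Fml) : Prop := ∀ σ : DState, φ.Sat σ

def Fml.imp (φ ψ : Fml) : Fml := .or (.not φ) ψ

def Fml.fls : Fml := .not .tru

def Fml.conj (l : List Fml) : Fml := l.foldr .and .tru

/-- Weak negation: negation (pushed through the connectives) which replaces `≤` by `≥` and `≥` by
`≤`, so that boundaries are kept. -/
def Fml.weakNeg : Fml → Fml
  | .le a b => .ge a b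
  | .ge a b => .le a b
  | .not φ => φ
  | .and φ ψ => .or φ.weakNeg ψ.weakNeg
  | .or φ ψ => .and φ.weakNeg ψ.weakNeg
  | φ => .not φ

def HProg.skip : HProg := .test .tru

def HProg.seqs (l : List HProg) : HProg := l.foldr .seq .skip

def HProg.ite (φ : Fml) (α β : HProg) : HProg :=
  .choice (.seq (.test φ) α) (.seq (.test (.not φ)) β)

def HProg.while (φ : Fml) (α : HProg) : HProg :=
  .seq (.star (.seq (.test φ) α)) (.test (.not φ))

/-- `φ(e₁, …, eₙ)`: the formula `φ` after the simultaneous assignment of the values of the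
arguments to the parameters. -/
def Fml.instantiate (params : List DVar) (args : List Term) (φ : Fml) : Fml :=
  .box (.seq
      (HProg.seqs (args.zipIdx.map fun p => .assign (.tmp p.2) p.1))
      (HProg.seqs (params.zipIdx.map fun p =>
        if p.2 < args.length then .assign p.1 (.var (.tmp p.2)) else .skip))) φ

/-! ## Hybrid active objects: abstract syntax -/

abbrev ClassId := ℕ
abbrev MethodId := ℕ
/-- Identifiers of program points. -/
abbrev PointId := ℕ

/-- Assignable locations: fields (of `this`) and local variables (including parameters). Names are
program-wide identifiers. -/
inductive HVar where
  | field (f : ℕ)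
  | loc (v : ℕ)

def HVar.trans : HVar → DVar
  | .field f => .field f
  | .loc v => .loc v

/-- Side-effect free expressions. -/
inductive Expr where
  | lit (r : ℝ)
  | tru
  | var (x : HVar)
  | self
  | add (a b : Expr)
  | sub (a b : Expr)
  | mul (a b : Expr)
  | div (a b : Expr)
  | le (a b : Expr)
  | ge (a b : Expr)
  | and (a b : Expr)
  | or (a b : Expr)
  | not (a : Expr)

/-- Differential expressions. -/
inductive DExpr where
  | base (e : Expr)
  | diff (e : Expr)
  | add (a b : DExpr)
  | sub (a b : DExpr)
  | mul (a b : DExpr)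
  | div (a b : DExpr)

/-- Guards `e?`, `duration(e)` and `diff e`. -/
inductive Guard where
  | poll (e : Expr)
  | duration (e : Expr)
  | diff (e : Expr)

/-- Right-hand sides. In `call e C m args`, which is `e!m(args)`, the class `C` is the static type
of the callee `e`, i.e., the called method is `C.m`. -/
inductive Rhs where
  | expr (e : Expr)
  | new (C : ClassId) (args : List Expr)
  | get (e : Expr)
  | call (e : Expr) (C : ClassId) (m : MethodId) (args : List Expr)

/-- Statements. The target of an assignment is optional; `ret none` terminates a process that has
no return value. -/
inductive Stmt where
  | skip
  | assign (x : Option HVar) (rhs : Rhs)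
  | seq (s₁ s₂ : Stmt)
  | ite (e : Expr) (s₁ s₂ : Stmt)
  | while (e : Expr) (s : Stmt)
  | await (p : PointId) (g : Guard)
  | duration (e : Expr)
  | ret (e : Option Expr)

/-- A statement followed by termination, with an optional return value. -/
structure Block where
  stmt : Stmt
  ret : Option Expr

def Block.code (b : Block) : Stmt := .seq b.stmt (.ret b.ret)

/-- A method. Its code is the leading `await` statement followed by the block `body`. -/
structure Method where
  name : MethodId
  params : List ℕ
  pre : Fml
  post : Fml
  leadPoint : PointId
  lead : Guard
  body : Block

def Method.code (d : Method) : Stmt := .seq (.await d.leadPoint d.lead) d.body.code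

/-- Declaration of a physical field: its initial value and the right-hand side of its equation. -/
structure PhysDecl where
  field : ℕ
  init : Expr
  deriv : DExpr

/-- A class: parameters (discrete fields passed on creation), further discrete fields, physical
block, initializing block, methods, creation condition and object invariant. -/
structure ClassDecl where
  name : ClassId
  params : List ℕ
  fields : List ℕ
  phys : List PhysDecl
  init : Block
  methods : List Method
  creation : Fml
  inv : Fml

/-- The code of the constructor: the physical fields get their initial values, and then the
initializing block runs. -/
def ClassDecl.initCode (c : ClassDecl) : Stmt :=
  c.phys.foldr (fun d s => .seq (.assign (some (.field d.field)) (.expr d.init)) s) c.init.code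

structure Program where
  classes : List ClassDecl
  main : Block

def Program.findClass (P : Program) (C : ClassId) : Option ClassDecl :=
  P.classes.find? fun c => c.name == C

def ClassDecl.findMethod (c : ClassDecl) (m : MethodId) : Option Method :=
  c.methods.find? fun d => d.name == m

def Program.findMethod (P : Program) (C : ClassId) (m : MethodId) : Option Method :=
  (P.findClass C).bind fun c => c.findMethod m

/-- The units of code: the main block, the constructors `C.init` and the methods `C.m`. -/
inductive CodeUnit where
  | main
  | init (C : ClassId)
  | method (C : ClassId) (m : MethodId)

/-- The class a unit belongs to; `none` stands for the main block. -/
def CodeUnit.owner : CodeUnit → Option ClassId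
  | .main => none
  | .init C => some C
  | .method C _ => some C

def Program.code (P : Program) : CodeUnit → Option Stmt
  | .main => some P.main.code
  | .init C => (P.findClass C).map ClassDecl.initCode
  | .method C m => (P.findMethod C m).map Method.code

/-- The statement contains a call of the method `C.m`. -/
def Stmt.Calls (C : ClassId) (m : MethodId) : Stmt → Prop
  | .assign _ (.call _ C' m' _) => C' = C ∧ m' = m
  | .seq s₁ s₂ => s₁.Calls C m ∨ s₂.Calls C m
  | .ite _ s₁ s₂ => s₁.Calls C m ∨ s₂.Calls C m
  | .while _ s => s.Calls C m
  | _ => False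

/-- The unit `u` of the program contains a call of the method `C.m`. -/
def Program.Calls (P : Program) (u : CodeUnit) (C : ClassId) (m : MethodId) : Prop :=
  ∃ s, P.code u = some s ∧ s.Calls C m

/-- The class `C` declares a method with the name `m`. -/
def Program.HasMethod (P : Program) (C : ClassId) (m : MethodId) : Prop :=
  ∃ d, P.findMethod C m = some d

/-- Class names are unique, method names are unique within each class, and every called method is
declared. -/
structure Program.WellFormed (P : Program) : Prop where
  classNames : (P.classes.map ClassDecl.name).Nodup
  methodNames : ∀ c ∈ P.classes, (c.methods.map Method.name).Nodup
  callsDeclared : ∀ u C m, P.Calls u C m → P.HasMethod C m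

/-! ## Translation into hybrid programs -/

def Expr.toTerm : Expr → Term
  | .lit r => .const r
  | .tru => .const 1
  | .var x => .var x.trans
  | .self => .var .self
  | .add a b => .add a.toTerm b.toTerm
  | .sub a b => .sub a.toTerm b.toTerm
  | .mul a b => .mul a.toTerm b.toTerm
  | .div a b => .div a.toTerm b.toTerm
  | .le a b => .le a.toTerm b.toTerm
  | .ge a b => .ge a.toTerm b.toTerm
  | .and a b => .and a.toTerm b.toTerm
  | .or a b => .or a.toTerm b.toTerm
  | .not a => .not a.toTerm

/-- A Boolean expression as a formula. -/
def Expr.toFml : Expr → Fml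
  | .tru => .tru
  | .le a b => .le a.toTerm b.toTerm
  | .ge a b => .ge a.toTerm b.toTerm
  | .and a b => .and a.toFml b.toFml
  | .or a b => .or a.toFml b.toFml
  | .not a => .not a.toFml
  | e => .eq e.toTerm (.const 1)

def DExpr.trans : DExpr → DTerm
  | .base e => .base e.toTerm
  | .diff e => .diff e.toTerm
  | .add a b => .add a.trans b.trans
  | .sub a b => .sub a.trans b.trans
  | .mul a b => .mul a.trans b.trans
  | .div a b => .div a.trans b.trans

/-- Only differential guards are translated; all other guards become `true`. -/
def Guard.trans : Guard → Fml
  | .diff e => e.toFml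
  | _ => .tru

def ClassDecl.ode (c : ClassDecl) : ODE :=
  c.phys.map fun d => (.field d.field, d.deriv.trans)

def ClassDecl.physFields (c : ClassDecl) : List ℕ := c.phys.map PhysDecl.field

def ClassDecl.allFields (c : ClassDecl) : List ℕ := c.params ++ c.fields ++ c.physFields

/-- `pr(ψ, inv, ode)`: the invariant holds now and along the dynamics inside the region `ψ`. -/
noncomputable def prFml (ψ inv : Fml) (ode : ODE) : Fml :=
  .and inv (.box (.seq (.assign .time (.const 0))
    (.ode (ode ++ [(.time, .base (.const 1))]) ψ)) inv)

/-- What the translation of a statement depends on: fields, dynamics and invariant of the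
surrounding class, the post-regions of the `await` statements of the surrounding unit, and
parameters and preconditions of methods and constructors. -/
structure TransCtx where
  fields : List ℕ
  physFields : List ℕ
  ode : ODE
  inv : Fml
  region : PointId → Fml
  contract : ClassId → MethodId → List DVar × Fml
  creation : ClassId → List DVar × Fml

namespace TransCtx

noncomputable def pr (Γ : TransCtx) (ψ : Fml) : Fml := prFml ψ Γ.inv Γ.ode

def havoc (Γ : TransCtx) : HProg := HProg.seqs (Γ.fields.map fun f => .havoc (.field f))

def havocPhys (Γ : TransCtx) : HProg := HProg.seqs (Γ.physFields.map fun f => .havoc (.field f))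

end TransCtx

noncomputable def failProg : HProg := .assign .cll (.const 1)

/-- `{?φ} ∪ {?¬φ; fail}` -/
noncomputable def checkProg (φ : Fml) : HProg :=
  .choice (.test φ) (.seq (.test (.not φ)) failProg)

/-- `x := *`, if there is a target `x`. -/
def havocTarget : Option HVar → HProg
  | some x => .havoc x.trans
  | none => .skip

noncomputable def Stmt.trans (Γ : TransCtx) : Stmt → HProg
  | .skip => .skip
  | .assign (some x) (.expr e) => .assign x.trans e.toTerm
  | .assign none (.expr _) => .skip
  | .assign x (.get _) =>
      .choice
        (HProg.seqs [.test (Γ.pr .tru), Γ.havocPhys, .test Γ.inv, havocTarget x])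
        (HProg.seqs [.test (.not (Γ.pr .tru)), failProg, Γ.havocPhys, havocTarget x])
  | .assign x (.call _ C m args) =>
      .seq (checkProg
          (Fml.instantiate (Γ.contract C m).1 (args.map Expr.toTerm) (Γ.contract C m).2))
        (havocTarget x)
  | .assign x (.new C args) =>
      .seq (checkProg
          (Fml.instantiate (Γ.creation C).1 (args.map Expr.toTerm) (Γ.creation C).2))
        (havocTarget x)
  | .seq s₁ s₂ => .seq (s₁.trans Γ) (s₂.trans Γ)
  | .ite e s₁ s₂ => .ite e.toFml (s₁.trans Γ) (s₂.trans Γ)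
  | .while e s => .while e.toFml (s.trans Γ)
  | .await p g =>
      let φ := Γ.pr (.and (Γ.region p) g.trans.weakNeg)
      .choice
        (HProg.seqs [.test φ, Γ.havoc, .test (.and g.trans Γ.inv)])
        (HProg.seqs [.test (.not φ), failProg, Γ.havoc, .test g.trans])
  | .duration e =>
      HProg.seqs [
        .assign .time (.const 0),
        checkProg (Γ.pr (.le (.var .time) e.toTerm)),
        .assign .time (.const 0),
        .ode (Γ.ode ++ [(.time, .base (.const 1))]) (.le (.var .time) e.toTerm),
        .test (.ge (.var .time) e.toTerm)]
  | .ret (some e) => .assign .result e.toTerm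
  | .ret none => .skip

/-- The two ways to read the translation of the `await` statement a method starts with: like every
other `await` statement (`full`), or, as the first activation of the process starts right after this
statement, as the test of its guard (`test`). -/
inductive LeadMode where
  | full
  | test

noncomputable def Method.trans (mode : LeadMode) (Γ : TransCtx) (d : Method) : HProg :=
  match mode with
  | .full => d.code.trans Γ
  | .test => .seq (.test d.lead.trans) (d.body.code.trans Γ)

/-! ## Proof obligation scheme -/

/-- What a post-region is assigned to: the termination of a unit, or an `await` statement in it. -/
inductive RegionPoint where
  | term (u : CodeUnit)
  | await (u : CodeUnit) (p : PointId)

/-- Post-region generators. -/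
abbrev Generator := RegionPoint → Fml

def Program.contract (P : Program) (C : ClassId) (m : MethodId) : List DVar × Fml :=
  match P.findMethod C m with
  | some d => (d.params.map .loc, d.pre)
  | none => ([], .tru)

def Program.creation (P : Program) (C : ClassId) : List DVar × Fml :=
  match P.findClass C with
  | some c => (c.params.map .field, c.creation)
  | none => ([], .tru)

def Program.classCtx (P : Program) (Ψ : Generator) (c : ClassDecl) (u : CodeUnit) : TransCtx where
  fields := c.allFields
  physFields := c.physFields
  ode := c.ode
  inv := c.inv
  region p := Ψ (.await u p)
  contract := P.contract
  creation := P.creation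

/-- The main block runs in a special object without fields, dynamics and invariant. -/
def Program.mainCtx (P : Program) (Ψ : Generator) : TransCtx where
  fields := []
  physFields := []
  ode := []
  inv := .tru
  region p := Ψ (.await .main p)
  contract := P.contract
  creation := P.creation

/-- `cll ≐ 0` -/
noncomputable def cllZero : Fml := .eq (.var .cll) (.const 0)

/-- The proof obligation of a unit under the generator `Ψ` (`none` if there is no such unit). -/
noncomputable def Program.obligation (P : Program) (mode : LeadMode) (Ψ : Generator) :
    CodeUnit → Option Fml
  | .main => some (.imp cllZero (.box (P.main.code.trans (P.mainCtx Ψ)) cllZero))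
  | .init C => (P.findClass C).map fun c =>
      .imp (.and c.creation cllZero)
        (.box (c.initCode.trans (P.classCtx Ψ c (.init C)))
          (.and cllZero (prFml (Ψ (.term (.init C))) c.inv c.ode)))
  | .method C m => (P.findClass C).bind fun c => (c.findMethod m).map fun d =>
      .imp (.and c.inv (.and d.pre cllZero))
        (.box (d.trans mode (P.classCtx Ψ c (.method C m)))
          (.and cllZero (.and d.post (prFml (Ψ (.term (.method C m))) c.inv c.ode))))

/-! ## Causality graphs -/

/-- Nodes of the causality graph: one node per basic statement, and for branchings and loops two
additional nodes, `in` (`false`) and `out` (`true`). -/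
def Stmt.Node : Stmt → Type
  | .seq s₁ s₂ => s₁.Node ⊕ s₂.Node
  | .ite _ s₁ s₂ => Bool ⊕ (s₁.Node ⊕ s₂.Node)
  | .while _ s => Bool ⊕ s.Node
  | _ => Unit

def Stmt.entry : (s : Stmt) → s.Node
  | .seq s₁ _ => .inl s₁.entry
  | .ite _ _ _ => .inl false
  | .while _ _ => .inl false
  | .skip => ()
  | .assign _ _ => ()
  | .await _ _ => ()
  | .duration _ => ()
  | .ret _ => ()

def Stmt.exit : (s : Stmt) → s.Node
  | .seq _ s₂ => .inr s₂.exit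
  | .ite _ _ _ => .inl true
  | .while _ _ => .inl true
  | .skip => ()
  | .assign _ _ => ()
  | .await _ _ => ()
  | .duration _ => ()
  | .ret _ => ()

/-- The edges of the causality graph. -/
def Stmt.Edge : (s : Stmt) → s.Node → s.Node → Prop
  | .seq s₁ _, .inl v, .inl w => s₁.Edge v w
  | .seq s₁ s₂, .inl v, .inr w => v = s₁.exit ∧ w = s₂.entry
  | .seq _ s₂, .inr v, .inr w => s₂.Edge v w
  | .ite _ s₁ _, .inl false, .inr (.inl w) => w = s₁.entry
  | .ite _ _ s₂, .inl false, .inr (.inr w) => w = s₂.entry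
  | .ite _ s₁ _, .inr (.inl v), .inl true => v = s₁.exit
  | .ite _ _ s₂, .inr (.inr v), .inl true => v = s₂.exit
  | .ite _ s₁ _, .inr (.inl v), .inr (.inl w) => s₁.Edge v w
  | .ite _ _ s₂, .inr (.inr v), .inr (.inr w) => s₂.Edge v w
  | .while _ _, .inl false, .inl true => True
  | .while _ s, .inl false, .inr w => w = s.entry
  | .while _ s, .inr v, .inl false => v = s.exit
  | .while _ s, .inr v, .inr w => s.Edge v w
  | _, _, _ => False

/-- The basic statement at a node (`none` for the additional nodes). -/
def Stmt.label : (s : Stmt) → s.Node → Option Stmt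
  | .seq s₁ _, .inl v => s₁.label v
  | .seq _ s₂, .inr v => s₂.label v
  | .ite _ _ _, .inl _ => none
  | .ite _ s₁ _, .inr (.inl v) => s₁.label v
  | .ite _ _ s₂, .inr (.inr v) => s₂.label v
  | .while _ _, .inl _ => none
  | .while _ s, .inr v => s.label v
  | .skip, _ => some .skip
  | .assign x rhs, _ => some (.assign x rhs)
  | .await p g, _ => some (.await p g)
  | .duration e, _ => some (.duration e)
  | .ret e, _ => some (.ret e)

def Stmt.IsAwaitNode (s : Stmt) (v : s.Node) : Prop :=
  ∃ p g, s.label v = some (.await p g)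

/-- The node is a call to `this` of the method `C.m`. -/
def Stmt.IsSelfCallNode (s : Stmt) (C : ClassId) (m : MethodId) (v : s.Node) : Prop :=
  ∃ x args, s.label v = some (.assign x (.call .self C m args))

/-- `l` is a method path of the node `n`: a path to `n` that starts in the entry node, or in an
`await` node and then has at least one edge, and that has no `await` node strictly between its first
and its last node. -/
def Stmt.IsMethodPath (s : Stmt) (n : s.Node) (l : List s.Node) : Prop :=
  l.IsChain s.Edge ∧ l.getLast? = some n ∧
  (l.head? = some s.entry ∨ (2 ≤ l.length ∧ ∃ v, l.head? = some v ∧ s.IsAwaitNode v)) ∧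
  ∀ v ∈ l.tail.dropLast, ¬ s.IsAwaitNode v

/-- Every method path of the node `n` contains a call of `C.m` on `this`. -/
def Stmt.GuaranteedAt (s : Stmt) (C : ClassId) (m : MethodId) (n : s.Node) : Prop :=
  ∀ l, s.IsMethodPath n l → ∃ v ∈ l, s.IsSelfCallNode C m v

/-- The methods of the class `C` that are guaranteed to be called at a given point of a unit. -/
def Program.gcall (P : Program) (C : ClassId) : RegionPoint → Set MethodId
  | .term u => {m | ∃ s, P.code u = some s ∧ s.GuaranteedAt C m s.exit}
  | .await u p => {m | ∃ s, P.code u = some s ∧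
      ∀ n g, s.label n = some (.await p g) → s.GuaranteedAt C m n}

/-! ## Locally controlled regions -/

/-- External trigger of a guard. -/
def Guard.trigger : Guard → Fml
  | .diff e => e.toFml
  | .duration e => .ge (.var .time) e.toTerm
  | .poll _ => .fls

def RegionPoint.unit : RegionPoint → CodeUnit
  | .term u => u
  | .await u _ => u

open Classical in
/-- The generator of locally controlled regions: the conjunction of the weakly negated external
triggers of the leading guards of all methods that are guaranteed to be called on `this`. -/
noncomputable def Program.localRegion (P : Program) : Generator := fun x =>
  match x.unit.owner.bind P.findClass with
  | none => .tru
  | some c => Fml.conj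
      ((c.methods.filter fun d => d.name ∈ P.gcall c.name x).map fun d => d.lead.trigger.weakNeg)

/-- The proof obligation of the unit `u` for locally controlled regions is valid. -/
def Program.Proven (P : Program) (mode : LeadMode) (u : CodeUnit) : Prop :=
  ∀ φ, P.obligation mode P.localRegion u = some φ → φ.Valid

/-- All proof obligations of a class (`some C`: constructor and methods) or of the main block
(`none`) for locally controlled regions are valid. -/
def Program.Verified (P : Program) (mode : LeadMode) (D : Option ClassId) : Prop :=
  ∀ u : CodeUnit, u.owner = D → P.Proven mode u

/-! ## Removal and addition of methods -/

/-- Replaces every call of `C.m` by `skip`. -/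
def Stmt.eraseCalls (C : ClassId) (m : MethodId) : Stmt → Stmt
  | .assign x (.call e C' m' args) =>
      if C' = C ∧ m' = m then .skip else .assign x (.call e C' m' args)
  | .seq s₁ s₂ => .seq (s₁.eraseCalls C m) (s₂.eraseCalls C m)
  | .ite e s₁ s₂ => .ite e (s₁.eraseCalls C m) (s₂.eraseCalls C m)
  | .while e s => .while e (s.eraseCalls C m)
  | s => s

/-- Applies `F` to the block of every unit of the program. -/
def Program.mapBlocks (P : Program) (F : CodeUnit → Block → Block) : Program where
  classes := P.classes.map fun c => { c with
    init := F (.init c.name) c.init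
    methods := c.methods.map fun d => { d with body := F (.method c.name d.name) d.body } }
  main := F .main P.main

/-- Applies `F` to the list of methods of the class `C`. -/
def Program.mapMethods (P : Program) (C : ClassId) (F : List Method → List Method) : Program where
  classes := P.classes.map fun c => if c.name = C then { c with methods := F c.methods } else c
  main := P.main

/-- The program after the removal of `C.m`: the method is removed from the class, and all calls to
it are replaced by `skip`. -/
def Program.removeMethod (P : Program) (C : ClassId) (m : MethodId) : Program :=
  (P.mapMethods C fun l => l.filter fun d => d.name ≠ m).mapBlocks fun _ b =>
    { b with stmt := b.stmt.eraseCalls C m }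

/-- The program after adding the method `d` to the class `C`. -/
def Program.addMethod (P : Program) (C : ClassId) (d : Method) : Program :=
  P.mapMethods C fun l => l ++ [d]

/-- The program after replacing the block of `u` by `b`, for all `u` with `edit u = some b`. -/
def Program.editBlocks (P : Program) (edit : CodeUnit → Option Block) : Program :=
  P.mapBlocks fun u b => (edit u).getD b

-- The obligation of a unit is a formula computed from few data: the code of the unit, the code-free
-- part of its class (fields, dynamics, invariant, creation condition, its own contract), the
-- contracts of the methods it calls, the creation conditions, and the local regions at its
-- termination and its `await` points. If a unit does not call `C.m` and keeps its code, none of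
-- these data changes when `C.m` is added or removed. Its obligations in the two programs are then
-- the same formula, so no reasoning about validity is needed.
--
-- The delicate data are the regions, because they range over the method list of the class, and
-- "every method path contains a call" could hold vacuously. It does not: every node of a causality
-- graph is reachable from the entry, hence has a method path (`Stmt.exists_isMethodPath`). A
-- guaranteed call is therefore a call in the code (`Stmt.not_guaranteedAt`), and the trigger of
-- `C.m` is absent from the regions of units that do not call it.
--
-- `Program.AgreeExcept` expresses that two programs differ only in code and in `C.m`, and
-- `Program.AgreeExcept.obligation` is the resulting equality of obligations. It remains to see that
-- non-calling units keep their code. Erasing calls does not affect them. For an addition without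
-- edits, well-formedness excludes earlier calls to the undeclared name. With edits, every replaced
-- block contains a call. The converse directions of the equivalences are specializations of
-- `Verified`.

/-- Structural induction on statements. -/
@[elab_as_elim]
theorem Stmt.induction {motive : Stmt → Prop} (skip : motive .skip)
    (assign : ∀ x rhs, motive (.assign x rhs))
    (seq : ∀ s₁ s₂, motive s₁ → motive s₂ → motive (.seq s₁ s₂))
    (ite : ∀ e s₁ s₂, motive s₁ → motive s₂ → motive (.ite e s₁ s₂))
    (loop : ∀ e s, motive s → motive (.while e s))
    (await : ∀ p g, motive (.await p g)) (duration : ∀ e, motive (.duration e))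
    (ret : ∀ e, motive (.ret e)) (s : Stmt) : motive s :=
  Stmt.rec skip assign seq ite loop await duration ret s

/-! ## Causality graphs: existence of method paths -/

/-- The edges ignore the values of conditions, and `ret` is an ordinary node with successors, so no
code is dead. -/
theorem Stmt.entry_reaches (s : Stmt) : ∀ v : s.Node, Relation.ReflTransGen s.Edge s.entry v := by
  induction s using Stmt.induction with
  | seq s₁ s₂ ih₁ ih₂ =>
    have left (v : s₁.Node) :
        Relation.ReflTransGen (Stmt.seq s₁ s₂).Edge (.inl s₁.entry) (.inl v) :=
      (ih₁ v).lift Sum.inl fun _ _ h => h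
    rintro (v | v)
    · exact left v
    · exact ((left s₁.exit).tail (c := Sum.inr s₂.entry) ⟨rfl, rfl⟩).trans
        ((ih₂ v).lift Sum.inr fun _ _ h => h)
  | ite e s₁ s₂ ih₁ ih₂ =>
    have left (v : s₁.Node) :
        Relation.ReflTransGen (Stmt.ite e s₁ s₂).Edge (.inl false) (.inr (.inl v)) :=
      (Relation.ReflTransGen.single
          (show (Stmt.ite e s₁ s₂).Edge (.inl false) (.inr (.inl s₁.entry)) from rfl)).trans
        ((ih₁ v).lift (fun w => Sum.inr (Sum.inl w)) fun _ _ h => h)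
    rintro (b | v | v)
    · cases b
      · exact .refl
      · exact (left s₁.exit).tail (c := Sum.inl true) rfl
    · exact left v
    · exact (Relation.ReflTransGen.single
          (show (Stmt.ite e s₁ s₂).Edge (.inl false) (.inr (.inr s₂.entry)) from rfl)).trans
        ((ih₂ v).lift (fun w => Sum.inr (Sum.inr w)) fun _ _ h => h)
  | loop e s ih =>
    rintro (b | v)
    · cases b
      · exact .refl
      · exact .single (show (Stmt.while e s).Edge (.inl false) (.inl true) from trivial)
    · exact (Relation.ReflTransGen.single
          (show (Stmt.while e s).Edge (.inl false) (.inr s.entry) from rfl)).trans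
        ((ih v).lift Sum.inr fun _ _ h => h)
  | _ => exact fun _ => .refl

/-- A path from the entry may cross `await` nodes, so it is cut at the last one before `n`. The
induction along reachability does this on the fly, restarting the path whenever it leaves an `await`
node. -/
theorem Stmt.exists_isMethodPath (s : Stmt) (n : s.Node) : ∃ l, s.IsMethodPath n l := by
  induction s.entry_reaches n with
  | refl => exact ⟨[s.entry], by simp [Stmt.IsMethodPath]⟩
  | @tail v w _ hvw ih =>
    by_cases hv : s.IsAwaitNode v
    · exact ⟨[v, w], by simpa [Stmt.IsMethodPath, hvw] using Or.inr hv⟩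
    · obtain ⟨l, hchain, hlast, hhead, hmid⟩ := ih
      have hne : l ≠ [] := by rintro rfl; simp at hlast
      have hhead' : (l ++ [w]).head? = l.head? := by
        cases l with
        | nil => exact absurd rfl hne
        | cons => rfl
      refine ⟨l ++ [w], ?_, by simp, ?_, ?_⟩
      · rw [List.isChain_append]
        refine ⟨hchain, by simp, ?_⟩
        simpa [hlast] using hvw
      · rw [hhead']
        refine hhead.imp_right fun h => ⟨?_, h.2⟩
        have := h.1
        simp only [List.length_append]
        omega
      -- The only new interior node of the extended path is `v`, the former last node, which is not
      -- an `await` node here. If `l` is a single node, the interior is empty.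
      · intro a ha
        rw [List.tail_append_of_ne_nil hne, List.dropLast_concat] at ha
        have htail : l.tail ≠ [] := List.ne_nil_of_mem ha
        have hlast' : l.tail.getLast htail = v := by
          rw [List.getLast_tail]
          exact Option.some_injective _ ((List.getLast?_eq_some_getLast hne).symm.trans hlast)
        rw [← List.dropLast_append_getLast htail, List.mem_append, List.mem_singleton,
          hlast'] at ha
        rcases ha with ha | rfl
        · exact hmid a ha
        · exact hv

theorem Stmt.calls_of_isSelfCallNode {C : ClassId} {m : MethodId} (s : Stmt) :
    ∀ v : s.Node, s.IsSelfCallNode C m v → s.Calls C m := by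
  induction s using Stmt.induction with
  | seq s₁ s₂ ih₁ ih₂ =>
    rintro (v | v) h
    · exact Or.inl (ih₁ v h)
    · exact Or.inr (ih₂ v h)
  | ite e s₁ s₂ ih₁ ih₂ =>
    rintro (b | v | v) h
    · obtain ⟨_, _, h⟩ := h
      cases h
    · exact Or.inl (ih₁ v h)
    · exact Or.inr (ih₂ v h)
  | loop e s ih =>
    rintro (b | v) h
    · obtain ⟨_, _, h⟩ := h
      cases h
    · exact ih v h
  | assign x rhs =>
    rintro v ⟨y, args, h⟩
    cases h
    exact ⟨rfl, rfl⟩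
  | _ =>
    rintro v ⟨_, _, h⟩
    cases h

/-- Existence of a method path makes the universal quantifier in `GuaranteedAt` non-vacuous. -/
theorem Stmt.not_guaranteedAt {C : ClassId} {m : MethodId} {s : Stmt} (hs : ¬ s.Calls C m)
    (n : s.Node) : ¬ s.GuaranteedAt C m n := fun h => by
  obtain ⟨l, hl⟩ := s.exists_isMethodPath n
  obtain ⟨v, -, hv⟩ := h l hl
  exact hs (s.calls_of_isSelfCallNode v hv)

/-! ## The translation depends only on what a statement uses -/

/-- The statement contains an `await` statement with the identifier `p`. -/
def Stmt.AwaitsAt (s : Stmt) (p : PointId) : Prop := ∃ n g, s.label n = some (.await p g)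

/-- Regions are compared only at `await` points that occur in `s`. At an absent identifier the
quantifier over nodes in `gcall` is vacuous once the unit has code, so every method name counts as
guaranteed and the regions of two programs may differ. -/
theorem Stmt.trans_congr {Γ Δ : TransCtx} (hfields : Γ.fields = Δ.fields)
    (hphys : Γ.physFields = Δ.physFields) (hode : Γ.ode = Δ.ode) (hinv : Γ.inv = Δ.inv)
    (hcreation : Γ.creation = Δ.creation) (s : Stmt)
    (hregion : ∀ p, s.AwaitsAt p → Γ.region p = Δ.region p)
    (hcontract : ∀ D k, s.Calls D k → Γ.contract D k = Δ.contract D k) :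
    s.trans Γ = s.trans Δ := by
  induction s using Stmt.induction with
  | seq s₁ s₂ ih₁ ih₂ =>
    rw [Stmt.trans, Stmt.trans,
      ih₁ (fun p ⟨n, g, h⟩ => hregion p ⟨.inl n, g, h⟩) fun D k h => hcontract D k (.inl h),
      ih₂ (fun p ⟨n, g, h⟩ => hregion p ⟨.inr n, g, h⟩) fun D k h => hcontract D k (.inr h)]
  | ite e s₁ s₂ ih₁ ih₂ =>
    rw [Stmt.trans, Stmt.trans,
      ih₁ (fun p ⟨n, g, h⟩ => hregion p ⟨.inr (.inl n), g, h⟩)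
        fun D k h => hcontract D k (.inl h),
      ih₂ (fun p ⟨n, g, h⟩ => hregion p ⟨.inr (.inr n), g, h⟩)
        fun D k h => hcontract D k (.inr h)]
  | loop e s ih =>
    rw [Stmt.trans, Stmt.trans,
      ih (fun p ⟨n, g, h⟩ => hregion p ⟨.inr n, g, h⟩) hcontract]
  | assign x rhs =>
    cases rhs with
    | expr e => cases x <;> simp only [Stmt.trans]
    | new D args => simp only [Stmt.trans, hcreation]
    | get e => simp only [Stmt.trans, TransCtx.pr, TransCtx.havocPhys, hinv, hode, hphys]
    | call e D k args => simp only [Stmt.trans, hcontract D k ⟨rfl, rfl⟩]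
  | await p g =>
    simp only [Stmt.trans, TransCtx.pr, TransCtx.havoc, hinv, hode, hfields,
      hregion p ⟨(), g, rfl⟩]
  | duration e => simp only [Stmt.trans, TransCtx.pr, hinv, hode]
  | ret e => cases e <;> simp only [Stmt.trans]
  | skip => simp only [Stmt.trans]

/-! ## Programs that agree up to code and one method -/

/-- The method without its code. -/
def Method.signature (d : Method) : Method := { d with body := ⟨.skip, none⟩ }

/-- The class without code and without the method `C.m`. -/
def ClassDecl.interface (C : ClassId) (m : MethodId) (c : ClassDecl) : ClassDecl :=
  { c with
    init := ⟨.skip, none⟩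
    methods := (c.methods.filter fun d => ¬ (c.name = C ∧ d.name = m)).map Method.signature }

/-- The classes of the programs agree up to code and up to the method `C.m`. -/
def Program.AgreeExcept (C : ClassId) (m : MethodId) (P Q : Program) : Prop :=
  P.classes.map (ClassDecl.interface C m) = Q.classes.map (ClassDecl.interface C m)

/-- Meant for an `f` that ignores the body, such as a projection to another component; then `hf` is
`rfl`. The version for interfaces below serves the same purpose. -/
theorem Method.congr_of_signature_eq {α : Type*} {d d' : Method} (f : Method → α)
    (hf : ∀ d : Method, f d.signature = f d) (h : d.signature = d'.signature) : f d = f d' := by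
  rw [← hf d, h, hf]

theorem ClassDecl.congr_of_interface_eq {α : Type*} {C : ClassId} {m : MethodId}
    {c c' : ClassDecl} (f : ClassDecl → α) (hf : ∀ c : ClassDecl, f (c.interface C m) = f c)
    (h : c.interface C m = c'.interface C m) : f c = f c' := by
  rw [← hf c, h, hf]

theorem List.find?_map_of_forall {α β : Type*} {f : α → β} {p : α → Bool} {q : β → Bool}
    (h : ∀ a, q (f a) = p a) (l : List α) : (l.map f).find? q = (l.find? p).map f := by
  rw [List.find?_map]
  congr 2
  exact funext h

theorem ClassDecl.findMethod_interface {C D : ClassId} {m k : MethodId} (c : ClassDecl)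
    (hc : c.name = D) (hk : ¬ (D = C ∧ k = m)) :
    (c.interface C m).findMethod k = (c.findMethod k).map Method.signature := by
  unfold ClassDecl.findMethod ClassDecl.interface
  rw [List.find?_map_of_forall (p := fun d => d.name == k) fun _ => rfl, List.find?_filter]
  congr 2
  funext d
  -- A method named `k` survives the filter because `(D, k)` differs from `(C, m)`; the other
  -- methods are irrelevant to the lookup.
  by_cases hd : d.name = k
  · subst hc hd
    simpa [imp_iff_not_or] using hk
  · simp [hd]

theorem Program.findClass_name {P : Program} {D : ClassId} {c : ClassDecl}
    (h : P.findClass D = some c) : c.name = D := by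
  simpa using List.find?_some h

namespace Program.AgreeExcept

variable {P Q : Program} {C : ClassId} {m : MethodId}

theorem findClass (h : P.AgreeExcept C m Q) (D : ClassId) :
    (P.findClass D).map (ClassDecl.interface C m) =
      (Q.findClass D).map (ClassDecl.interface C m) := by
  have key (R : Program) : (R.findClass D).map (ClassDecl.interface C m) =
      (R.classes.map (ClassDecl.interface C m)).find? fun c => c.name == D :=
    (List.find?_map_of_forall (p := fun c : ClassDecl => c.name == D) (fun _ => rfl) _).symm
  rw [key, key, h]

/-- Corresponding classes are either both missing, or they have the same interface. -/
theorem findClass_cases (h : P.AgreeExcept C m Q) (D : ClassId) :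
    (P.findClass D = none ∧ Q.findClass D = none) ∨
      ∃ c c', P.findClass D = some c ∧ Q.findClass D = some c' ∧
        c.interface C m = c'.interface C m := by
  have := h.findClass D
  cases hc : P.findClass D <;> cases hc' : Q.findClass D <;> simp_all

theorem findMethod (h : P.AgreeExcept C m Q) {D : ClassId} {k : MethodId}
    (hk : ¬ (D = C ∧ k = m)) :
    (P.findMethod D k).map Method.signature = (Q.findMethod D k).map Method.signature := by
  unfold Program.findMethod
  rcases h.findClass_cases D with ⟨hP, hQ⟩ | ⟨c, c', hP, hQ, hcc⟩
  · simp [hP, hQ]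
  · simp only [hP, hQ, Option.bind_some]
    rw [← c.findMethod_interface (findClass_name hP) hk, hcc,
      c'.findMethod_interface (findClass_name hQ) hk]

theorem contract (h : P.AgreeExcept C m Q) {D : ClassId} {k : MethodId}
    (hk : ¬ (D = C ∧ k = m)) : P.contract D k = Q.contract D k := by
  have := h.findMethod hk
  unfold Program.contract
  cases hd : P.findMethod D k with
  | none =>
    cases hd' : Q.findMethod D k with
    | none => rfl
    | some d' => simp [hd, hd'] at this
  | some d =>
    cases hd' : Q.findMethod D k with
    | none => simp [hd, hd'] at this
    | some d' =>
      rw [hd, hd', Option.map_some, Option.map_some, Option.some_inj] at this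
      have h₁ : d.params = d'.params := Method.congr_of_signature_eq (·.params) (fun _ => rfl) this
      have h₂ : d.pre = d'.pre := Method.congr_of_signature_eq (·.pre) (fun _ => rfl) this
      simp only [h₁, h₂]

theorem creation (h : P.AgreeExcept C m Q) : P.creation = Q.creation := by
  funext D
  unfold Program.creation
  rcases h.findClass_cases D with ⟨hP, hQ⟩ | ⟨c, c', hP, hQ, hcc⟩
  · simp only [hP, hQ]
  · have h₁ : c.params = c'.params := ClassDecl.congr_of_interface_eq (·.params) (fun _ => rfl) hcc
    have h₂ : c.creation = c'.creation := ClassDecl.congr_of_interface_eq (·.creation) (fun _ => rfl) hcc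
    simp only [hP, hQ, h₁, h₂]

end Program.AgreeExcept

-- The triggers entering a region can be read off the interface: leading guards belong to the
-- signature, and the method dropped from the interface is not in `G` anyway.
open Classical in
theorem ClassDecl.filter_interface_methods {C : ClassId} {m : MethodId} (c : ClassDecl)
    (G : Set MethodId) (hG : c.name = C → m ∉ G) :
    (c.methods.filter fun d => d.name ∈ G).map (fun d => d.lead.trigger.weakNeg) =
      ((c.interface C m).methods.filter fun d => d.name ∈ G).map
        fun d => d.lead.trigger.weakNeg := by
  unfold ClassDecl.interface
  simp only [List.filter_map, List.map_map, List.filter_filter]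
  have : (c.methods.filter fun d => d.name ∈ G) = c.methods.filter fun d =>
      ((fun d => decide (d.name ∈ G)) ∘ Method.signature) d &&
        decide ¬ (c.name = C ∧ d.name = m) := by
    refine List.filter_congr fun d _ => ?_
    rw [Bool.eq_iff_iff, Bool.and_eq_true, decide_eq_true_eq, decide_eq_true_eq]
    exact ⟨fun hd => ⟨decide_eq_true hd, fun ⟨h₁, h₂⟩ => hG h₁ (h₂ ▸ hd)⟩,
      fun hd => of_decide_eq_true hd.1⟩
  rw [this]
  rfl

theorem Program.AgreeExcept.localRegion {P Q : Program} {C : ClassId} {m : MethodId}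
    (h : P.AgreeExcept C m Q) (x : RegionPoint)
    (hcode : P.code x.unit = Q.code x.unit) (hx : m ∉ P.gcall C x) :
    P.localRegion x = Q.localRegion x := by
  -- The set `gcall` looks at the program only through the code of the unit.
  have hgcall (D : ClassId) : P.gcall D x = Q.gcall D x := by
    cases x <;> simp only [RegionPoint.unit] at hcode <;> simp only [Program.gcall, hcode]
  unfold Program.localRegion
  cases x.unit.owner with
  | none => rfl
  | some D =>
    simp only [Option.bind_some]
    rcases h.findClass_cases D with ⟨hP, hQ⟩ | ⟨c, c', hP, hQ, hcc⟩
    · simp only [hP, hQ]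
    · have hname : c.name = c'.name := ClassDecl.congr_of_interface_eq (·.name) (fun _ => rfl) hcc
      simp only [hP, hQ]
      rw [c.filter_interface_methods (C := C) (m := m) _ fun hc => hc ▸ hx,
        c'.filter_interface_methods (C := C) (m := m) _
          fun hc => by rw [hc, ← hgcall]; exact hx, hcc, hname, hgcall]

theorem Program.not_mem_gcall_term {P : Program} {u : CodeUnit} {C : ClassId} {m : MethodId}
    (hu : ¬ P.Calls u C m) : m ∉ P.gcall C (.term u) := by
  rintro ⟨s, hs, hg⟩
  exact Stmt.not_guaranteedAt (fun h => hu ⟨s, hs, h⟩) _ hg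

theorem Program.not_mem_gcall_await {P : Program} {u : CodeUnit} {C : ClassId} {m : MethodId}
    {s : Stmt} (hs : P.code u = some s) (hu : ¬ P.Calls u C m) {p : PointId}
    (hp : s.AwaitsAt p) : m ∉ P.gcall C (.await u p) := by
  rintro ⟨s', hs', hg⟩
  obtain rfl : s = s' := Option.some_injective _ (hs.symm.trans hs')
  obtain ⟨n, g, hn⟩ := hp
  exact Stmt.not_guaranteedAt (fun h => hu ⟨s, hs, h⟩) _ (hg n g hn)

/-- The obligation of a unit depends only on its code, the interfaces of the classes, and the
methods that it calls. -/
theorem Program.AgreeExcept.obligation {P Q : Program} {C : ClassId} {m : MethodId}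
    (h : P.AgreeExcept C m Q) (mode : LeadMode) {u : CodeUnit} (hcode : P.code u = Q.code u)
    (hu : ¬ P.Calls u C m) (hne : u ≠ .method C m) :
    P.obligation mode P.localRegion u = Q.obligation mode Q.localRegion u := by
  have hterm : P.localRegion (.term u) = Q.localRegion (.term u) :=
    h.localRegion _ hcode (not_mem_gcall_term hu)
  have hawait {s : Stmt} (hs : P.code u = some s) (p : PointId) (hp : s.AwaitsAt p) :
      P.localRegion (.await u p) = Q.localRegion (.await u p) :=
    h.localRegion _ hcode (not_mem_gcall_await hs hu hp)
  have hcontract {s : Stmt} (hs : P.code u = some s) (D : ClassId) (k : MethodId)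
      (hk : s.Calls D k) : P.contract D k = Q.contract D k :=
    h.contract fun ⟨h₁, h₂⟩ => hu ⟨s, hs, h₁ ▸ h₂ ▸ hk⟩
  -- The statement `s` is left arbitrary, since in the mode `test` only the body of a method is
  -- translated this way, without its leading `await`.
  have hclass {c c' : ClassDecl} (hcc : c.interface C m = c'.interface C m) {s : Stmt}
      (hregion : ∀ p, s.AwaitsAt p → P.localRegion (.await u p) = Q.localRegion (.await u p))
      (hcalls : ∀ D k, s.Calls D k → P.contract D k = Q.contract D k) :
      s.trans (P.classCtx P.localRegion c u) = s.trans (Q.classCtx Q.localRegion c' u) := by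
    have hphys : c.phys = c'.phys := ClassDecl.congr_of_interface_eq (·.phys) (fun _ => rfl) hcc
    have hparams : c.params = c'.params := ClassDecl.congr_of_interface_eq (·.params) (fun _ => rfl) hcc
    have hfields : c.fields = c'.fields := ClassDecl.congr_of_interface_eq (·.fields) (fun _ => rfl) hcc
    refine Stmt.trans_congr ?_ ?_ ?_ (ClassDecl.congr_of_interface_eq (·.inv) (fun _ => rfl) hcc :) h.creation s hregion hcalls
    · simp only [Program.classCtx, ClassDecl.allFields, ClassDecl.physFields, hphys, hparams,
        hfields]
    · simp only [Program.classCtx, ClassDecl.physFields, hphys]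
    · simp only [Program.classCtx, ClassDecl.ode, hphys]
  cases u with
  | main =>
    have hmain : P.main.code = Q.main.code := Option.some_injective _ hcode
    simp only [Program.obligation, ← hmain]
    rw [Stmt.trans_congr (Γ := P.mainCtx P.localRegion) (Δ := Q.mainCtx Q.localRegion)
      rfl rfl rfl rfl h.creation P.main.code (hawait rfl) (hcontract rfl)]
  | init D =>
    simp only [Program.code] at hcode hawait hcontract
    simp only [Program.obligation]
    rcases h.findClass_cases D with ⟨hP, hQ⟩ | ⟨c, c', hP, hQ, hcc⟩
    · simp only [hP, hQ, Option.map_none]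
    · simp only [hP, hQ, Option.map_some, Option.some_inj, forall_eq'] at hcode hawait hcontract ⊢
      have h₁ : c.creation = c'.creation := ClassDecl.congr_of_interface_eq (·.creation) (fun _ => rfl) hcc
      have h₂ : c.inv = c'.inv := ClassDecl.congr_of_interface_eq (·.inv) (fun _ => rfl) hcc
      have h₃ : c.phys = c'.phys := ClassDecl.congr_of_interface_eq (·.phys) (fun _ => rfl) hcc
      rw [← hcode, hclass hcc hawait hcontract, hterm, h₁, h₂, ClassDecl.ode, ClassDecl.ode, h₃]
  | method D k =>
    simp only [Program.code, Program.findMethod] at hcode hawait hcontract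
    simp only [Program.obligation]
    have hsig := h.findMethod (D := D) (k := k) fun ⟨h₁, h₂⟩ => hne (by rw [h₁, h₂])
    simp only [Program.findMethod] at hsig
    rcases h.findClass_cases D with ⟨hP, hQ⟩ | ⟨c, c', hP, hQ, hcc⟩
    · simp only [hP, hQ, Option.bind_none]
    · simp only [hP, hQ, Option.bind_some] at hcode hawait hcontract hsig ⊢
      cases hd : c.findMethod k with
      | none =>
        cases hd' : c'.findMethod k with
        | none => rfl
        | some d' => simp [hd, hd'] at hsig
      | some d =>
        cases hd' : c'.findMethod k with
        | none => simp [hd, hd'] at hsig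
        | some d' =>
          simp only [hd, hd', Option.map_some, Option.some_inj, forall_eq']
            at hcode hawait hcontract hsig ⊢
          have h₁ : d.pre = d'.pre := Method.congr_of_signature_eq (·.pre) (fun _ => rfl) hsig
          have h₂ : d.post = d'.post := Method.congr_of_signature_eq (·.post) (fun _ => rfl) hsig
          have h₃ : c.inv = c'.inv := ClassDecl.congr_of_interface_eq (·.inv) (fun _ => rfl) hcc
          have h₄ : c.phys = c'.phys := ClassDecl.congr_of_interface_eq (·.phys) (fun _ => rfl) hcc
          have h₅ : d.trans mode (P.classCtx P.localRegion c (.method D k)) =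
              d'.trans mode (Q.classCtx Q.localRegion c' (.method D k)) := by
            cases mode with
            | full =>
              simp only [Method.trans, ← hcode]
              exact hclass hcc hawait hcontract
            | test =>
              -- Equality of the full codes splits into equality of the leading guards, which become
              -- tests, and of the remaining codes.
              simp only [Method.code, Stmt.seq.injEq, Stmt.await.injEq] at hcode
              simp only [Method.trans, ← hcode.2, ← hcode.1.2]
              rw [hclass hcc (fun p ⟨n, g, hn⟩ => hawait p ⟨.inr n, g, hn⟩)
                fun D k hk => hcontract D k (.inr hk)]
          rw [h₅, hterm, h₁, h₂, h₃, ClassDecl.ode, ClassDecl.ode, h₄]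

/-! ## Code of transformed programs -/

/-- The block of a unit. -/
def Program.block (P : Program) : CodeUnit → Option Block
  | .main => some P.main
  | .init C => (P.findClass C).map ClassDecl.init
  | .method C m => (P.findMethod C m).map Method.body

theorem ClassDecl.calls_initCode {C : ClassId} {m : MethodId} (c : ClassDecl) :
    c.initCode.Calls C m ↔ c.init.stmt.Calls C m := by
  unfold ClassDecl.initCode
  induction c.phys with
  | nil => simp [Block.code, Stmt.Calls]
  | cons d l ih => simpa [Stmt.Calls] using ih

/-- Initializations of physical fields, leading `await` statements and returns contain no calls, so
all calls sit in the block, the part that program transformations rewrite. -/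
theorem Program.calls_iff {P : Program} {u : CodeUnit} {C : ClassId} {m : MethodId} :
    P.Calls u C m ↔ ∃ b, P.block u = some b ∧ b.stmt.Calls C m := by
  cases u with
  | main => simp [Program.Calls, Program.code, Program.block, Block.code, Stmt.Calls]
  | init D => simp [Program.Calls, Program.code, Program.block, ClassDecl.calls_initCode]
  | method D k =>
    simp [Program.Calls, Program.code, Program.block, Method.code, Block.code, Stmt.Calls]

theorem Stmt.eraseCalls_eq_self {C : ClassId} {m : MethodId} {s : Stmt} (h : ¬ s.Calls C m) :
    s.eraseCalls C m = s := by
  induction s using Stmt.induction with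
  | seq s₁ s₂ ih₁ ih₂ =>
    rw [Stmt.eraseCalls, ih₁ fun h' => h (.inl h'), ih₂ fun h' => h (.inr h')]
  | ite e s₁ s₂ ih₁ ih₂ =>
    rw [Stmt.eraseCalls, ih₁ fun h' => h (.inl h'), ih₂ fun h' => h (.inr h')]
  | loop e s ih => rw [Stmt.eraseCalls, ih h]
  | assign x rhs =>
    cases rhs with
    | call e D k args => exact if_neg h
    | _ => rfl
  | _ => rfl

-- Lookup and code after rewriting blocks or method lists.

theorem Program.findClass_mapBlocks (P : Program) (F : CodeUnit → Block → Block) (D : ClassId) :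
    (P.mapBlocks F).findClass D = (P.findClass D).map fun c => { c with
      init := F (.init D) c.init
      methods := c.methods.map fun d => { d with body := F (.method D d.name) d.body } } := by
  refine (List.find?_map_of_forall (fun _ => rfl) P.classes).trans (Option.map_congr ?_)
  rintro c hc
  simp only [findClass_name hc]

theorem Program.findMethod_mapBlocks (P : Program) (F : CodeUnit → Block → Block) (D : ClassId)
    (k : MethodId) :
    (P.mapBlocks F).findMethod D k =
      (P.findMethod D k).map fun d => { d with body := F (.method D k) d.body } := by
  simp only [Program.findMethod, findClass_mapBlocks]
  cases P.findClass D with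
  | none => rfl
  | some c =>
    refine (List.find?_map_of_forall (fun _ => rfl) c.methods).trans (Option.map_congr ?_)
    rintro d hd
    have : d.name = k := by simpa using List.find?_some hd
    simp only [this]

theorem Program.block_mapBlocks (P : Program) (F : CodeUnit → Block → Block) (u : CodeUnit) :
    (P.mapBlocks F).block u = (P.block u).map (F u) := by
  cases u with
  | main => rfl
  | init D => simp [Program.block, findClass_mapBlocks, Function.comp_def]
  | method D k => simp [Program.block, findMethod_mapBlocks, Function.comp_def]

theorem Program.code_mapBlocks_of_eq {P : Program} {F : CodeUnit → Block → Block} {u : CodeUnit}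
    (h : ∀ b, P.block u = some b → F u b = b) : (P.mapBlocks F).code u = P.code u := by
  cases u with
  | main =>
    simp only [Program.code, Program.mapBlocks, h P.main rfl]
  | init D =>
    simp only [Program.code, findClass_mapBlocks]
    cases hc : P.findClass D with
    | none => rfl
    | some c =>
      have := h c.init (by simp [Program.block, hc])
      simp only [Option.map_some, ClassDecl.initCode, this]
  | method D k =>
    simp only [Program.code, findMethod_mapBlocks]
    cases hd : P.findMethod D k with
    | none => rfl
    | some d =>
      have := h d.body (by simp [Program.block, hd])
      simp only [Option.map_some, Method.code, this]

theorem Program.findClass_mapMethods (P : Program) (C : ClassId) (F : List Method → List Method)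
    (D : ClassId) :
    (P.mapMethods C F).findClass D = (P.findClass D).map fun c =>
      if c.name = C then { c with methods := F c.methods } else c :=
  List.find?_map_of_forall (fun c => by split <;> rfl) P.classes

theorem Program.findMethod_mapMethods {P : Program} {C : ClassId} {F : List Method → List Method}
    {D : ClassId} {k : MethodId}
    (hF : D = C → ∀ l, (F l).find? (fun d => d.name == k) = l.find? fun d => d.name == k) :
    (P.mapMethods C F).findMethod D k = P.findMethod D k := by
  simp only [Program.findMethod, findClass_mapMethods]
  cases hc : P.findClass D with
  | none => rfl
  | some c =>
    have hname := findClass_name hc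
    simp only [Option.map_some, Option.bind_some]
    split
    · rename_i h
      exact hF (hname ▸ h) _
    · rfl

theorem Program.block_mapMethods {P : Program} {C : ClassId} {F : List Method → List Method}
    {m : MethodId} {u : CodeUnit} (hu : u ≠ .method C m)
    (hF : ∀ k ≠ m, ∀ l, (F l).find? (fun d => d.name == k) = l.find? fun d => d.name == k) :
    (P.mapMethods C F).block u = P.block u ∧ (P.mapMethods C F).code u = P.code u := by
  cases u with
  | main => exact ⟨rfl, rfl⟩
  | init D =>
    simp only [Program.block, Program.code, findClass_mapMethods, Option.map_map]
    constructor <;>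
    · congr 1
      funext c
      simp only [Function.comp]
      split <;> rfl
  | method D k =>
    have : (P.mapMethods C F).findMethod D k = P.findMethod D k :=
      findMethod_mapMethods fun h => hF k fun hk => hu (by rw [h, hk])
    simp only [Program.block, Program.code, this, and_self]

theorem Program.agreeExcept_mapMethods {C : ClassId} {m : MethodId} (P : Program)
    {F : List Method → List Method}
    (hF : ∀ l, (F l).filter (fun d => d.name ≠ m) = l.filter fun d => d.name ≠ m) :
    P.AgreeExcept C m (P.mapMethods C F) := by
  simp only [Program.AgreeExcept, Program.mapMethods, List.map_map]
  refine List.map_congr_left fun c _ => ?_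
  simp only [Function.comp]
  split
  · rename_i hc
    simp only [ClassDecl.interface, hc, true_and]
    simp only [ne_eq] at hF
    rw [hF]
  · rfl

theorem Program.agreeExcept_mapBlocks (C : ClassId) (m : MethodId) (P : Program)
    (F : CodeUnit → Block → Block) : P.AgreeExcept C m (P.mapBlocks F) := by
  simp only [Program.AgreeExcept, Program.mapBlocks, List.map_map]
  refine List.map_congr_left fun c _ => ?_
  simp only [Function.comp, ClassDecl.interface, List.filter_map, List.map_map]
  rfl

-- Removal and addition as instances of these rewritings.

theorem find?_filter_name_ne {k m : MethodId} (hk : k ≠ m) (l : List Method) :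
    (l.filter fun d => d.name ≠ m).find? (fun d => d.name == k) =
      l.find? fun d => d.name == k := by
  rw [List.find?_filter]
  congr 1
  funext d
  by_cases hd : d.name = k
  · simp [hd, hk]
  · simp [hd]

theorem find?_concat_of_name_ne {k : MethodId} {d : Method} (hk : k ≠ d.name) (l : List Method) :
    (l ++ [d]).find? (fun d => d.name == k) = l.find? fun d => d.name == k := by
  rw [List.find?_append, List.find?_singleton]
  simp [Ne.symm hk]

theorem Program.agreeExcept_removeMethod (P : Program) (C : ClassId) (m : MethodId) :
    P.AgreeExcept C m (P.removeMethod C m) :=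
  (P.agreeExcept_mapMethods fun l => by simp [List.filter_filter]).trans
    (Program.agreeExcept_mapBlocks C m _ _)

theorem Program.agreeExcept_editBlocks_addMethod (P : Program) (C : ClassId) (d : Method)
    (edit : CodeUnit → Option Block) :
    P.AgreeExcept C d.name ((P.editBlocks edit).addMethod C d) :=
  (P.agreeExcept_mapBlocks C d.name _).trans
    (Program.agreeExcept_mapMethods _ fun l => by simp)

theorem Program.code_removeMethod {P : Program} {C : ClassId} {m : MethodId} {u : CodeUnit}
    (hu : ¬ P.Calls u C m) (hne : u ≠ .method C m) :
    P.code u = (P.removeMethod C m).code u := by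
  obtain ⟨hblock, hcode⟩ := Program.block_mapMethods (P := P) hne
    (F := fun l => l.filter fun d => d.name ≠ m) fun k hk l => find?_filter_name_ne hk l
  rw [Program.removeMethod, Program.code_mapBlocks_of_eq, hcode]
  intro b hb
  rw [hblock] at hb
  rw [Stmt.eraseCalls_eq_self fun h => hu (Program.calls_iff.2 ⟨b, hb, h⟩)]

theorem Program.obligation_removeMethod_self (P : Program) (mode : LeadMode) (Ψ : Generator)
    (C : ClassId) (m : MethodId) :
    (P.removeMethod C m).obligation mode Ψ (.method C m) = none := by
  have hfind : (P.removeMethod C m).findMethod C m = none := by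
    rw [Program.removeMethod, Program.findMethod_mapBlocks, Program.findMethod,
      Program.findClass_mapMethods]
    cases hc : P.findClass C with
    | none => rfl
    | some c => simp [findClass_name hc, ClassDecl.findMethod]
  simp only [Program.obligation]
  unfold Program.findMethod at hfind
  cases hc : (P.removeMethod C m).findClass C with
  | none => rfl
  | some c =>
    rw [hc, Option.bind_some] at hfind
    simp [hfind]

theorem Program.code_addMethod {P : Program} {C : ClassId} {d : Method} {u : CodeUnit}
    (hne : u ≠ .method C d.name) :
    (P.addMethod C d).block u = P.block u ∧ (P.addMethod C d).code u = P.code u :=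
  Program.block_mapMethods hne fun _ hk l => find?_concat_of_name_ne hk l

theorem Program.code_editBlocks_addMethod {P : Program} {C : ClassId} {d : Method}
    {edit : CodeUnit → Option Block} (hedit : ∀ u b, edit u = some b → b.stmt.Calls C d.name)
    {u : CodeUnit} (hne : u ≠ .method C d.name)
    (hu : ¬ ((P.editBlocks edit).addMethod C d).Calls u C d.name) :
    ((P.editBlocks edit).addMethod C d).code u = P.code u := by
  obtain ⟨hblock, hcode⟩ := Program.code_addMethod (P := P.editBlocks edit) hne
  rw [hcode]
  refine Program.code_mapBlocks_of_eq fun b hb => ?_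
  cases he : edit u with
  | none => rfl
  -- The unit exists, so the replacement takes effect and brings a call of the new method into the
  -- new program, contrary to `hu`.
  | some b' =>
    refine absurd (Program.calls_iff.2 ⟨b', ?_, hedit u b' he⟩) hu
    rw [hblock, Program.editBlocks, Program.block_mapBlocks, hb, he]
    rfl

theorem Program.editBlocks_none (P : Program) : P.editBlocks (fun _ => none) = P := by
  simp [Program.editBlocks, Program.mapBlocks]

/-! ## Compositionality of verification -/

theorem Program.AgreeExcept.proven {P Q : Program} {C : ClassId} {m : MethodId}
    (h : P.AgreeExcept C m Q) {mode : LeadMode} {u : CodeUnit} (hcode : P.code u = Q.code u)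
    (hu : ¬ P.Calls u C m) (hne : u ≠ .method C m) (hproven : P.Proven mode u) :
    Q.Proven mode u := fun φ hφ =>
  hproven φ ((h.obligation mode hcode hu hne).trans hφ)

theorem Program.Verified.removeMethod {P : Program} {mode : LeadMode} {D : Option ClassId}
    (hD : P.Verified mode D) {C : ClassId} {m : MethodId}
    (h : ∀ u : CodeUnit, u.owner = D → P.Calls u C m → (P.removeMethod C m).Proven mode u) :
    (P.removeMethod C m).Verified mode D := by
  intro u hu
  by_cases hcalls : P.Calls u C m
  · exact h u hu hcalls
  by_cases hne : u = .method C m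
  · subst hne
    -- The removed method has no obligation left, so `Proven` holds vacuously.
    intro φ hφ
    rw [Program.obligation_removeMethod_self] at hφ
    cases hφ
  · exact (P.agreeExcept_removeMethod C m).proven (Program.code_removeMethod hcalls hne) hcalls
      hne (hD u hu)

theorem Program.Verified.editBlocks_addMethod {P : Program} {mode : LeadMode} {D : Option ClassId}
    (hD : P.Verified mode D) {C : ClassId} {d : Method} {edit : CodeUnit → Option Block}
    (hedit : ∀ u b, edit u = some b → b.stmt.Calls C d.name)
    (h : ∀ u : CodeUnit, u.owner = D →
      u = .method C d.name ∨ ((P.editBlocks edit).addMethod C d).Calls u C d.name →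
      ((P.editBlocks edit).addMethod C d).Proven mode u) :
    ((P.editBlocks edit).addMethod C d).Verified mode D := by
  intro u hu
  by_cases hne : u = .method C d.name
  · exact h u hu (.inl hne)
  by_cases hcalls : ((P.editBlocks edit).addMethod C d).Calls u C d.name
  · exact h u hu (.inr hcalls)
  have hcode := (Program.code_editBlocks_addMethod hedit hne hcalls).symm
  refine (P.agreeExcept_editBlocks_addMethod C d edit).proven hcode ?_ hne (hD u hu)
  -- Calls are assumed absent in the new program but must be absent in the old one; the unit has the
  -- same code in both.
  rintro ⟨s, hs, hcall⟩
  exact hcalls ⟨s, hcode ▸ hs, hcall⟩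

theorem Program.Verified.addMethod {P : Program} (hP : P.WellFormed) {mode : LeadMode}
    {D : Option ClassId} (hD : P.Verified mode D) {C : ClassId} {d : Method}
    (hd : ¬ P.HasMethod C d.name)
    (h : D = some C → (P.addMethod C d).Proven mode (.method C d.name)) :
    (P.addMethod C d).Verified mode D := by
  -- Pure addition is the case in which no block is replaced.
  have key := hD.editBlocks_addMethod (C := C) (d := d) (edit := fun _ => none) (by simp)
  rw [P.editBlocks_none] at key
  refine key fun u hu hor => ?_
  by_cases hne : u = .method C d.name
  · subst hne
    exact h hu.symm
  -- A call of the new method in an old unit would already be a call in `P` of an undeclared method.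
  · obtain ⟨s, hs, hcall⟩ := hor.resolve_left hne
    rw [(Program.code_addMethod hne).2] at hs
    exact absurd (hP.callsDeclared u C d.name ⟨s, hs, hcall⟩) hd

theorem mainTheorem10 (mode : LeadMode) (P : Program) (hP : P.WellFormed) (C : ClassId)
    (hC : ∃ c, P.findClass C = some c) (hsafe : P.Verified mode (some C)) :
    -- removal of a method
    (∀ m, P.HasMethod C m →
      ((P.removeMethod C m).Verified mode (some C) ↔
        ∀ u : CodeUnit, u.owner = some C → P.Calls u C m →
          (P.removeMethod C m).Proven mode u) ∧
      ∀ D : Option ClassId, P.Verified mode D →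
        (∀ u : CodeUnit, u.owner = D → P.Calls u C m → (P.removeMethod C m).Proven mode u) →
        (P.removeMethod C m).Verified mode D) ∧
    -- addition of a method
    (∀ d : Method, ¬ P.HasMethod C d.name →
      ((P.addMethod C d).Verified mode (some C) ↔
        (P.addMethod C d).Proven mode (.method C d.name)) ∧
      ∀ D : Option ClassId, D ≠ some C → P.Verified mode D → (P.addMethod C d).Verified mode D) ∧
    -- addition of a method together with new calls to it
    (∀ d : Method, ¬ P.HasMethod C d.name → ∀ edit : CodeUnit → Option Block,
      (∀ u b, edit u = some b → b.stmt.Calls C d.name) →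
      ∀ D : Option ClassId, P.Verified mode D →
        (∀ u : CodeUnit, u.owner = D →
          u = .method C d.name ∨ ((P.editBlocks edit).addMethod C d).Calls u C d.name →
          ((P.editBlocks edit).addMethod C d).Proven mode u) →
        ((P.editBlocks edit).addMethod C d).Verified mode D) := by
  refine ⟨fun m _ => ⟨⟨fun h u hu _ => h u hu, fun h => hsafe.removeMethod h⟩,
      fun D hD h => hD.removeMethod h⟩,
    fun d hd => ⟨⟨fun h => h _ rfl, fun h => hsafe.addMethod hP hd fun _ => h⟩,
      fun D hne hD => hD.addMethod hP hd fun h => absurd h hne⟩,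
    fun d _ edit hedit D hD h => hD.editBlocks_addMethod hedit h⟩
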